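/- For an integer $k\ge 3$, a $k$-uniform hypergraph consists of a finite vertex set and a family of $k$-element subsets of it, called edges. For $k$-uniform hypergraphs $\mathcal H$ and $\mathcal G$ write $\mathcal H\to\mathcal G$ if every coloring of the edges of $\mathcal H$ with two colors yields a monochromatic copy of $\mathcal G$ in $\mathcal H$. The size-Ramsey number $\hat R(\mathcal G)$ is the minimum number of edges of a $k$-uniform hypergraph $\mathcal H$ with $\mathcal H\to\mathcal G$. The $k$-uniform tight path $\mathcal P^{(k)}_{n,k-1}$ has vertex set $\{1,\dots,n\}$, and its edges are all sets of $k$ consecutive integers contained in $\{1,\dots,n\}$. **Theorem.** Fix an integer $k\ge 3$ and let $$\alpha=\frac{k-2}{\binom{k-1}{2}+1}.$$ Then $\hat R(\mathcal P^{(k)}_{n,k-1})$ is finite for every $n$, and, as $n\to\infty$, $$\hat R\bigl(\mathcal P^{(k)}_{n,k-1}\bigr)=O\bigl(n^{\,k-1-\alpha}(\log n)^{1+\alpha}\bigr),$$ where the implied constant depends only on $k$. -/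

import Mathlib

open Filter Asymptotics

namespace Hypergraph

/-- A hypergraph is `k`-uniform if each of its edges consists of exactly `k` vertices. -/
def IsUniform {V : Type*} (k : ℕ) (H : Hypergraph V) : Prop :=
  ∀ e ∈ H.edgeSet, e.encard = k

/-- `H` arrows `G`: for every coloring of the edges of `H` with two colors there are a color `b` and
an embedding `f` of the vertices of `G` into the vertices of `H` that maps each edge of `G` onto an
edge of `H` of color `b`. -/
def Arrows {V W : Type*} (H : Hypergraph V) (G : Hypergraph W) : Prop :=
  ∀ c : H.edgeSet → Bool, ∃ (b : Bool) (f : W → V),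
    Set.MapsTo f G.vertexSet H.vertexSet ∧ Set.InjOn f G.vertexSet ∧
    ∀ e ∈ G.edgeSet, ∃ h : f '' e ∈ H.edgeSet, c ⟨f '' e, h⟩ = b

/-- The size-Ramsey number of a `k`-uniform hypergraph `G`: the least number of edges of a finite
`k`-uniform hypergraph that arrows `G`. It takes values in `ℕ∞`, so that it would be `⊤` if there
were no such hypergraph. -/
noncomputable def sizeRamsey {W : Type*} (k : ℕ) (G : Hypergraph W) : ℕ∞ :=
  sInf {m : ℕ∞ | ∃ (V : Type) (H : Hypergraph V), H.vertexSet.Finite ∧ H.IsUniform k ∧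
    H.Arrows G ∧ H.edgeSet.encard = m}

/-- The `k`-uniform tight path on the vertex set `{1, …, n}`: the edges are the intervals
`{i, i + 1, …, i + k - 1}` of `k` consecutive vertices that lie in `{1, …, n}`. -/
def tightPath (k n : ℕ) : Hypergraph ℕ where
  vertexSet := Set.Icc 1 n
  edgeSet := {e | ∃ i : ℕ, 1 ≤ i ∧ i + k ≤ n + 1 ∧ e = Set.Ico i (i + k)}
  subset_vertexSet_of_mem_edgeSet' := by
    rintro e ⟨i, hi, hk, rfl⟩ x hx
    simp only [Set.mem_Ico, Set.mem_Icc] at hx ⊢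
    omega

end Hypergraph

/-! The host hypergraph consists of the `k`-cliques of a random graph on `N = 140 k² n` vertices
with edge density `1 / Q`. The graph is a uniformly random `ω : Sym2 V → Fin Q`, a pair being an
edge when its value is `0`, so every probability is a count of functions.

Three properties are needed. (a) There are more than `4h` times as many `k`-cliques as `(k -
1)`-cliques. (b) Expansion: among at most `n` disjoint `(k - 1)`-sets `B`, some member has fewer
than `2h` common neighbours in any given set of at most `2k|B|` vertices. (c) Every `j`-set has `O(N
/ Q ^ j)` common neighbours, so there are `O(N ^ k / Q ^ (k choose 2))` `k`-cliques.
`Finset.exists_zeroCliques` obtains all three at once by a first moment argument.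

Given a two-coloring, (a) makes the larger color class dense over its shadow, and pruning yields a
subfamily whose shadow has minimum degree `2h`. A depth-first search for a tight path in it
(`Finset.IsSearchState.exists_lt`) cannot stall: many discarded tails would be disjoint `(k -
1)`-sets whose extensions all lie in a small used set, against (b).

With `h` of order `log n`, (b) requires `Q ^ (k - 1) = O(n / log n)`. Taking `Q` about `(n / log n)
^ (1 / D)` with `D = (k - 1 choose 2) + 1 ≥ k - 1`, the edge count becomes the stated bound, because
`(k choose 2) / D = 1 + α`. -/

/-! ### Subfamilies of large minimum degree -/

open Finset in
/-- The vertices that extend `s` to a member of the family `F`. -/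
def Finset.extensions {V : Type*} [Fintype V] [DecidableEq V] (F : Finset (Finset V))
    (s : Finset V) : Finset V := {v | v ∉ s ∧ insert v s ∈ F}

open Finset in
theorem Finset.mem_extensions {V : Type*} [Fintype V] [DecidableEq V] {F : Finset (Finset V)}
    {s : Finset V} {v : V} : v ∈ F.extensions s ↔ v ∉ s ∧ insert v s ∈ F := by
  simp [extensions]

open Finset in
/-- A family with more than `d` members per member of its shadow contains a nonempty subfamily in
which every member of the shadow has at least `d` extensions. -/
theorem Finset.exists_subset_le_card_extensions {V : Type*} [Fintype V] [DecidableEq V]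
    (E : Finset (Finset V)) (d : ℕ) (h : d * #E.shadow < #E) :
    ∃ F ⊆ E, F.Nonempty ∧ ∀ s ∈ F.shadow, d ≤ #(F.extensions s) := by
  -- Take `F` maximizing `#F - d * #F.shadow`. The value at `E` is positive, so `F` is nonempty.
  -- Deleting the edges through a shadow member with fewer than `d` extensions would increase the
  -- value.
  obtain ⟨F, hF, hmax⟩ := E.powerset.exists_max_image
    (fun F => (#F : ℤ) - d * #F.shadow) ⟨E, mem_powerset_self E⟩
  have hE := hmax E (mem_powerset_self E)
  rw [mem_powerset] at hF
  refine ⟨F, hF, ?_, ?_⟩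
  · rw [nonempty_iff_ne_empty]
    rintro rfl
    simp only [card_empty, shadow_empty] at hE
    zify at h
    simp at hE
    linarith
  · intro s hs
    by_contra! hlt
    set F' := F \ (F.extensions s).image (fun v => insert v s) with hF'
    have h1 : (#F : ℤ) - #(F.extensions s) ≤ #F' := by
      have h2 := le_card_sdiff ((F.extensions s).image (fun v => insert v s)) F
      have h3 : #((F.extensions s).image (fun v => insert v s)) ≤ #(F.extensions s) :=
        card_image_le
      rw [← hF'] at h2
      omega
    have h4 : F'.shadow ⊆ F.shadow.erase s := by
      intro t ht
      rw [mem_erase]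
      refine ⟨?_, shadow_monotone sdiff_subset ht⟩
      rintro rfl
      obtain ⟨e, he, a, ha, rfl⟩ := mem_shadow_iff.1 ht
      rw [hF', mem_sdiff] at he
      refine he.2 (mem_image.2 ⟨a, mem_extensions.2 ⟨notMem_erase a e, ?_⟩, insert_erase ha⟩)
      rw [insert_erase ha]
      exact he.1
    have h5 := card_le_card h4
    rw [card_erase_of_mem hs] at h5
    have h6 : 0 < #F.shadow := card_pos.2 ⟨s, hs⟩
    have h7 := hmax F' (mem_powerset.2 (sdiff_subset.trans hF))
    have h8 : (#F'.shadow : ℤ) ≤ #F.shadow - 1 := by omega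
    have h9 : (d : ℤ) * #F'.shadow ≤ d * (#F.shadow - 1) := by gcongr
    have h10 : (#(F.extensions s) : ℤ) < d := by exact_mod_cast hlt
    linarith

/-! ### Tight paths by depth-first search -/

open Finset in
/-- A tight path on the `L` vertices `f 0, …, f (L - 1)` whose edges lie in the family `F`. -/
structure Finset.IsTightPath {V : Type*} [DecidableEq V] (F : Finset (Finset V)) (k : ℕ)
    (f : ℕ → V) (L : ℕ) : Prop where
  injOn : Set.InjOn f (Set.Iio L)
  mem : ∀ i, i + k ≤ L → (Ico i (i + k)).image f ∈ F

open Finset in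
theorem Finset.IsTightPath.mono {V : Type*} [DecidableEq V] {F : Finset (Finset V)} {k : ℕ}
    {f : ℕ → V} {L M : ℕ} (h : F.IsTightPath k f L) (hM : M ≤ L) : F.IsTightPath k f M :=
  ⟨h.injOn.mono fun _ hx => lt_of_lt_of_le hx hM, fun i hi => h.mem i (hi.trans hM)⟩

open Finset in
theorem Finset.IsTightPath.image_mem_shadow {V : Type*} [DecidableEq V] {F : Finset (Finset V)}
    {k : ℕ} {f : ℕ → V} {L i : ℕ} (h : F.IsTightPath k f L) (hk : 1 ≤ k) (hi : i + k ≤ L) :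
    (Ico i (i + (k - 1))).image f ∈ F.shadow ∧ (Ico (i + 1) (i + k)).image f ∈ F.shadow := by
  have hinj : ∀ x ∈ Ico i (i + k), ∀ y ∈ Ico i (i + k), f x = f y → x = y := by
    intro x hx y hy hxy
    rw [mem_Ico] at hx hy
    exact h.injOn (by simp; omega) (by simp; omega) hxy
  have key : ∀ a ∈ Ico i (i + k), ((Ico i (i + k)).erase a).image f ∈ F.shadow := by
    intro a ha
    refine mem_shadow_iff.2 ⟨_, h.mem i hi, f a, mem_image_of_mem f ha, ?_⟩
    ext x
    simp only [mem_erase, mem_image]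
    constructor
    · rintro ⟨hx, y, hy, rfl⟩
      exact ⟨y, ⟨fun h => hx (by rw [h]), hy⟩, rfl⟩
    · rintro ⟨y, ⟨hya, hy⟩, rfl⟩
      exact ⟨fun h => hya (hinj y hy a ha h), y, hy, rfl⟩
  constructor
  · convert key (i + (k - 1)) (by simp; omega) using 2
    ext x; simp; omega
  · convert key i (by simp; omega) using 2
    ext x
    simp

open Finset in
/-- Appending a vertex that extends the last `k - 1` vertices of a tight path. -/
theorem Finset.IsTightPath.update {V : Type*} [Fintype V] [DecidableEq V]
    {F : Finset (Finset V)} {k : ℕ} {f : ℕ → V} {L : ℕ} (h : F.IsTightPath k f L) (hk : 1 ≤ k)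
    (hL : k - 1 ≤ L) {v : V} (hv : v ∈ F.extensions ((Ico (L - (k - 1)) L).image f))
    (hvf : v ∉ (range L).image f) : F.IsTightPath k (Function.update f L v) (L + 1) := by
  have hfL : ∀ x, x < L → Function.update f L v x = f x := fun x hx =>
    Function.update_of_ne hx.ne _ _
  have hvx : ∀ x, x < L → f x ≠ v := fun x hx h => hvf (mem_image.2 ⟨x, by simpa using hx, h⟩)
  constructor
  · intro x hx y hy hxy
    simp only [Set.mem_Iio] at hx hy
    rcases Nat.lt_succ_iff_lt_or_eq.1 hx with hx | rfl
    · rcases Nat.lt_succ_iff_lt_or_eq.1 hy with hy | rfl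
      · rw [hfL x hx, hfL y hy] at hxy
        exact h.injOn hx hy hxy
      · rw [hfL x hx, Function.update_self] at hxy
        exact absurd hxy (hvx x hx)
    · rcases Nat.lt_succ_iff_lt_or_eq.1 hy with hy | rfl
      · rw [hfL y hy, Function.update_self] at hxy
        exact absurd hxy.symm (hvx y hy)
      · rfl
  · intro i hi
    rcases Nat.lt_or_ge L (i + k) with hik | hik
    · have h1 : Ico i (i + k) = insert L (Ico (L - (k - 1)) L) := by
        ext x; simp; omega
      rw [h1, image_insert, Function.update_self]
      have h2 : (Ico (L - (k - 1)) L).image (Function.update f L v)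
          = (Ico (L - (k - 1)) L).image f :=
        image_congr fun x hx => hfL x (by simp at hx; omega)
      rw [h2]
      exact (mem_extensions.1 hv).2
    · have h2 : (Ico i (i + k)).image (Function.update f L v) = (Ico i (i + k)).image f :=
        image_congr fun x hx => hfL x (by simp at hx; omega)
      rw [h2]
      exact h.mem i hik

open Finset in
/-- A state of the depth-first search for a tight path: a tight path with a nonempty tail, together
with a family `B` of discarded tails none of which can be extended outside of the vertices
that were used. -/
structure Finset.IsSearchState {V : Type*} [Fintype V] [DecidableEq V] (F : Finset (Finset V))
    (k : ℕ) (f : ℕ → V) (L : ℕ) (B : Finset (Finset V)) : Prop where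
  path : F.IsTightPath k f L
  le : k - 1 ≤ L
  tail : (Ico (L - (k - 1)) L).image f ∈ F.shadow
  card : ∀ β ∈ B, #β = k - 1
  mem_shadow : ∀ β ∈ B, β ∈ F.shadow
  disj : (B : Set (Finset V)).PairwiseDisjoint id
  disj_path : ∀ β ∈ B, Disjoint β ((range L).image f)
  closed : ∀ β ∈ B, F.extensions β ⊆ (range L).image f ∪ B.biUnion id

-- One step of the search: extend the path by an unused vertex, or move its tail to `B`. The first
-- adds a used vertex; the second keeps the used vertices and enlarges `B`. Either way the number of
-- used vertices plus `#B` grows, which forces termination.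
open Finset in
theorem Finset.IsSearchState.exists_lt {V : Type*} [Fintype V] [DecidableEq V]
    {F : Finset (Finset V)} {k n d : ℕ} (hk : 2 ≤ k)
    (hdeg : ∀ s ∈ F.shadow, d ≤ #(F.extensions s))
    (hexp : ∀ (B : Finset (Finset V)) (C : Finset V), B.Nonempty → #B ≤ n →
      (∀ β ∈ B, #β = k - 1) → (B : Set (Finset V)).PairwiseDisjoint id → #C ≤ 2 * k * #B →
      ∃ β ∈ B, #(F.extensions β ∩ C) < d)
    {f : ℕ → V} {L : ℕ} {B : Finset (Finset V)} (h : F.IsSearchState k f L B) (hL : L < n)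
    (hB : #B < n) :
    ∃ f' L' B', F.IsSearchState k f' L' B' ∧ #B' < n ∧
      #((range L).image f ∪ B.biUnion id) + #B
        < #((range L').image f' ∪ B'.biUnion id) + #B' := by
  have hle := h.le
  set S := (range L).image f ∪ B.biUnion id with hS
  set τ := (Ico (L - (k - 1)) L).image f with hτ
  by_cases hext : ∃ v ∈ F.extensions τ, v ∉ S
  · obtain ⟨v, hv, hvS⟩ := hext
    have hvf : v ∉ (range L).image f := fun hv => hvS (mem_union_left _ hv)
    have hvB : ∀ β ∈ B, v ∉ β := fun β hβ hv =>
      hvS (mem_union_right _ (mem_biUnion.2 ⟨β, hβ, hv⟩))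
    have himg : (range (L + 1)).image (Function.update f L v) = insert v ((range L).image f) := by
      rw [range_add_one, image_insert, Function.update_self]
      congr 1
      exact image_congr fun x hx => Function.update_of_ne (by simp at hx; omega) _ _
    have hS' : (range (L + 1)).image (Function.update f L v) ∪ B.biUnion id = insert v S := by
      rw [himg, insert_union]
    refine ⟨Function.update f L v, L + 1, B, ?_, hB, ?_⟩
    · have hp := h.path.update (by omega) h.le hv hvf
      refine ⟨hp, by omega, ?_, h.card, h.mem_shadow, h.disj, ?_, ?_⟩
      · have := (hp.image_mem_shadow (i := L + 1 - k) (by omega) (by omega)).2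
        convert this using 3 <;> omega
      · intro β hβ
        rw [himg, disjoint_insert_right]
        exact ⟨hvB β hβ, h.disj_path β hβ⟩
      · intro β hβ
        rw [hS']
        exact (h.closed β hβ).trans (subset_insert _ _)
    · rw [hS', card_insert_of_notMem hvS]
      omega
  · push Not at hext
    have hτS : τ ⊆ (range L).image f := image_subset_image fun x hx => by simp at hx ⊢; omega
    have hτc : #τ = k - 1 := by
      rw [hτ, card_image_of_injOn, Nat.card_Ico]
      · omega
      · intro x hx y hy
        simp only [coe_Ico, Set.mem_Ico] at hx hy
        exact h.path.injOn hx.2 hy.2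
    have hτB : τ ∉ B := by
      intro hm
      have h1 := (h.disj_path τ hm).mono_right hτS
      rw [disjoint_self_iff_empty] at h1
      rw [h1, card_empty] at hτc
      omega
    have hcard : ∀ β ∈ insert τ B, #β = k - 1 := by
      intro β hβ
      rcases mem_insert.1 hβ with rfl | hβ
      · exact hτc
      · exact h.card β hβ
    have hshadow : ∀ β ∈ insert τ B, β ∈ F.shadow := by
      intro β hβ
      rcases mem_insert.1 hβ with rfl | hβ
      · exact h.tail
      · exact h.mem_shadow β hβ
    have hclosed : ∀ β ∈ insert τ B, F.extensions β ⊆ S := by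
      intro β hβ
      rcases mem_insert.1 hβ with rfl | hβ
      · exact hext
      · exact h.closed β hβ
    have hdisj : ((insert τ B : Finset (Finset V)) : Set (Finset V)).PairwiseDisjoint id := by
      rw [coe_insert]
      refine h.disj.insert fun β hβ _ => ?_
      exact ((h.disj_path β hβ).mono_right hτS).symm
    have hins : #(insert τ B) = #B + 1 := card_insert_of_notMem hτB
    have hbU : #(B.biUnion id) ≤ #B * (k - 1) :=
      card_biUnion_le_card_mul _ _ _ fun β hβ => (h.card β hβ).le
    have hfU : #((range L).image f) ≤ L := by simpa using card_image_le (s := range L) (f := f)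
    have hSc : #S ≤ L + #B * (k - 1) := (card_union_le _ _).trans (by omega)
    have hmul : (#B + 1) * (k - 1) = #B * (k - 1) + (k - 1) := by ring
    have hmul2 : 2 * k * (#B + 1) = 2 * ((#B + 1) * (k - 1)) + 2 * (#B + 1) := by
      obtain ⟨j, rfl⟩ : ∃ j, k = j + 1 := ⟨k - 1, by omega⟩
      simp only [Nat.add_sub_cancel]
      ring
    -- All extensions of the members of `insert τ B` lie in `S`, so a small `S` would contradict
    -- expansion and the minimum degree.
    have hbig : ¬ #S ≤ 2 * k * (#B + 1) := by
      intro hle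
      obtain ⟨β, hβ, hlt⟩ := hexp (insert τ B) S (insert_nonempty _ _) (by omega) hcard hdisj
        (by rwa [hins])
      rw [inter_eq_left.2 (hclosed β hβ)] at hlt
      exact absurd (hdeg β (hshadow β hβ)) (by omega)
    -- Since `#S ≤ L + #B * (k - 1)`, the lower bound on `#S` keeps `#B` below `n` (as `L < n`), and
    -- leaves a path of at least `k - 1` vertices after the tail is removed.
    have hB' : #B + 1 < n := by
      by_contra hcon
      exact hbig (by omega)
    have hL2 : 2 * (k - 1) ≤ L := by
      by_contra hcon
      exact hbig (by omega)
    have hS' : (range (L - (k - 1))).image f ∪ (insert τ B).biUnion id = S := by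
      rw [biUnion_insert, ← union_assoc, id, hτ, ← image_union, hS]
      congr 2
      ext x; simp; omega
    refine ⟨f, L - (k - 1), insert τ B, ?_, by omega, ?_⟩
    · refine ⟨h.path.mono (by omega), by omega, ?_, hcard, hshadow, hdisj, ?_, ?_⟩
      · have := (h.path.image_mem_shadow (i := L - (k - 1) - (k - 1)) (by omega) (by omega)).1
        convert this using 3; omega
      · intro β hβ
        rcases mem_insert.1 hβ with rfl | hβ
        · rw [disjoint_left]
          intro x hx hx'
          obtain ⟨y, hy, rfl⟩ := mem_image.1 hx
          obtain ⟨z, hz, hzy⟩ := mem_image.1 hx'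
          simp only [mem_Ico, mem_range] at hy hz
          have := h.path.injOn (by simp; omega) (by simp; omega) hzy
          omega
        · exact (h.disj_path β hβ).mono_right (image_subset_image fun x hx => by simp at hx ⊢; omega)
      · intro β hβ
        rw [hS']
        exact hclosed β hβ
    · rw [hS', hins]
      omega

open Finset in
/-- A family of large minimum degree in which disjoint sets expand contains a long tight path. -/
theorem Finset.exists_isTightPath {V : Type*} [Fintype V] [DecidableEq V]
    {F : Finset (Finset V)} {k n d : ℕ} (hk : 2 ≤ k) (hn : 1 ≤ n) (hF : F.Nonempty)
    (hunif : ∀ e ∈ F, #e = k) (hdeg : ∀ s ∈ F.shadow, d ≤ #(F.extensions s))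
    (hexp : ∀ (B : Finset (Finset V)) (C : Finset V), B.Nonempty → #B ≤ n →
      (∀ β ∈ B, #β = k - 1) → (B : Set (Finset V)).PairwiseDisjoint id → #C ≤ 2 * k * #B →
      ∃ β ∈ B, #(F.extensions β ∩ C) < d) :
    ∃ f : ℕ → V, F.IsTightPath k f n := by
  by_contra! hcon
  -- Without a path on `n` vertices the search would run forever, although its potential is at most
  -- `Fintype.card V + n`.
  have key : ∀ m : ℕ, ∃ f L B, F.IsSearchState k f L B ∧ #B < n ∧
      m ≤ #((range L).image f ∪ B.biUnion id) + #B := by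
    intro m
    induction m with
    | zero =>
      obtain ⟨e, he⟩ := hF
      have hec := hunif e he
      obtain ⟨a, ha⟩ : e.Nonempty := card_pos.1 (by omega)
      have hs : e.erase a ∈ F.shadow := erase_mem_shadow he ha
      have hsc : #(e.erase a) = k - 1 := by rw [card_erase_of_mem ha, hec]
      let φ := (e.erase a).equivFinOfCardEq hsc
      let f : ℕ → V := fun i => if hi : i < k - 1 then (φ.symm ⟨i, hi⟩ : V) else a
      have himg : (range (k - 1)).image f = e.erase a := by
        ext x
        rw [mem_image]
        constructor
        · rintro ⟨i, hi, rfl⟩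
          rw [mem_range] at hi
          simp only [f, hi, dif_pos]
          exact (φ.symm ⟨i, hi⟩).2
        · intro hx
          refine ⟨φ ⟨x, hx⟩, by simp, ?_⟩
          simp [f]
      -- A shadow member in any order is a path on `k - 1` vertices with no edges.
      refine ⟨f, k - 1, ∅, ⟨⟨?_, ?_⟩, le_rfl, ?_, ?_, ?_, ?_, ?_, ?_⟩, ?_, Nat.zero_le _⟩
      · intro x hx y hy hxy
        simp only [Set.mem_Iio] at hx hy
        simp only [f, hx, hy, dif_pos] at hxy
        have := φ.symm.injective (Subtype.ext hxy)
        simpa using this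
      · intro i hi
        omega
      · rw [Nat.sub_self, ← range_eq_Ico, himg]
        exact hs
      all_goals simp
      omega
    | succ m ih =>
      obtain ⟨f, L, B, hst, hB, hm⟩ := ih
      have hL : L < n := by
        by_contra hL
        exact hcon f (hst.path.mono (by omega))
      obtain ⟨f', L', B', h1, h2, h3⟩ := hst.exists_lt hk hdeg hexp hL hB
      exact ⟨f', L', B', h1, h2, by omega⟩
  obtain ⟨f, L, B, -, hB, hm⟩ := key (Fintype.card V + n)
  have := card_le_univ ((range L).image f ∪ B.biUnion id)
  omega

/-! ### From expansion to the arrow relation -/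

theorem Hypergraph.Arrows.tightPath_mono {V : Type*} {H : Hypergraph V} {k m n : ℕ} (h : n ≤ m)
    (hH : H.Arrows (Hypergraph.tightPath k m)) : H.Arrows (Hypergraph.tightPath k n) := by
  intro c
  obtain ⟨b, f, h1, h2, h3⟩ := hH c
  have hsub : (Hypergraph.tightPath k n).vertexSet ⊆ (Hypergraph.tightPath k m).vertexSet :=
    Set.Icc_subset_Icc le_rfl h
  refine ⟨b, f, h1.mono_left hsub, h2.mono hsub, ?_⟩
  rintro e ⟨i, hi, hik, rfl⟩
  exact h3 _ ⟨i, hi, by omega, rfl⟩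

/-- Transfers finiteness from large `n`, where the construction applies, to all `n`. -/
theorem Hypergraph.sizeRamsey_tightPath_mono {k m n : ℕ} (h : n ≤ m) :
    Hypergraph.sizeRamsey k (Hypergraph.tightPath k n)
      ≤ Hypergraph.sizeRamsey k (Hypergraph.tightPath k m) := by
  apply sInf_le_sInf
  rintro x ⟨V, H, h1, h2, h3, h4⟩
  exact ⟨V, H, h1, h2, h3.tightPath_mono h, h4⟩

-- The factor `2` pays for passing to the larger color class. Expansion bounds extensions from
-- above, so it is inherited by every subfamily of `E`.
open Finset in
theorem Hypergraph.sizeRamsey_tightPath_le {V : Type} [Fintype V] [DecidableEq V]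
    {E : Finset (Finset V)} {k n d : ℕ} (hk : 2 ≤ k) (hn : 1 ≤ n)
    (hunif : ∀ e ∈ E, #e = k) (hE : 2 * d * #E.shadow < #E)
    (hexp : ∀ (B : Finset (Finset V)) (C : Finset V), B.Nonempty → #B ≤ n →
      (∀ β ∈ B, #β = k - 1) → (B : Set (Finset V)).PairwiseDisjoint id → #C ≤ 2 * k * #B →
      ∃ β ∈ B, #(E.extensions β ∩ C) < d) :
    Hypergraph.sizeRamsey k (Hypergraph.tightPath k n) ≤ #E := by
  let H : Hypergraph V :=
    { vertexSet := Set.univ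
      edgeSet := (fun e : Finset V => (e : Set V)) '' (E : Set (Finset V))
      subset_vertexSet_of_mem_edgeSet' := fun _ _ => Set.subset_univ _ }
  refine sInf_le ⟨V, H, Set.finite_univ, ?_, ?_, ?_⟩
  · rintro _ ⟨e, he, rfl⟩
    rw [Set.encard_coe_eq_coe_finsetCard, hunif e he]
  · classical
    intro c
    let D : Bool → Finset (Finset V) := fun b =>
      {e ∈ E | ∃ h : (e : Set V) ∈ H.edgeSet, c ⟨e, h⟩ = b}
    have hDE : ∀ b, D b ⊆ E := fun b => filter_subset _ _
    have hcover : E ⊆ D true ∪ D false := by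
      intro e he
      have heH : (e : Set V) ∈ H.edgeSet := ⟨e, he, rfl⟩
      rw [mem_union, mem_filter, mem_filter]
      rcases hc : c ⟨e, heH⟩ with _ | _
      · exact Or.inr ⟨he, heH, hc⟩
      · exact Or.inl ⟨he, heH, hc⟩
    have hb : ∃ b, d * #E.shadow < #(D b) := by
      by_contra! hcon
      have h1 := (card_le_card hcover).trans (card_union_le _ _)
      have h2 := hcon true
      have h3 := hcon false
      have h4 : 2 * d * #E.shadow = d * #E.shadow + d * #E.shadow := by ring
      omega
    obtain ⟨b, hb⟩ := hb
    obtain ⟨F, hFD, hFne, hFdeg⟩ := (D b).exists_subset_le_card_extensions d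
      (lt_of_le_of_lt (Nat.mul_le_mul_left _ (card_le_card (shadow_mono (hDE b)))) hb)
    have hFE : F ⊆ E := hFD.trans (hDE b)
    obtain ⟨f, hf⟩ := exists_isTightPath (F := F) (k := k) (n := n) (d := d) hk hn hFne
      (fun e he => hunif e (hFE he)) hFdeg (by
        intro B C hB hBn hBc hBd hC
        obtain ⟨β, hβ, hlt⟩ := hexp B C hB hBn hBc hBd hC
        refine ⟨β, hβ, lt_of_le_of_lt (card_le_card (inter_subset_inter_right ?_)) hlt⟩
        intro v hv
        rw [mem_extensions] at hv ⊢
        exact ⟨hv.1, hFE hv.2⟩)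
    -- The shift accounts for `tightPath` starting at `1` and `IsTightPath` at `0`.
    refine ⟨b, fun i => f (i - 1), fun _ _ => Set.mem_univ _, ?_, ?_⟩
    · intro x hx y hy hxy
      have hx' : 1 ≤ x ∧ x ≤ n := hx
      have hy' : 1 ≤ y ∧ y ≤ n := hy
      have := hf.injOn (by simp; omega) (by simp; omega) hxy
      omega
    · rintro _ ⟨i, hi, hik, rfl⟩
      have h1 := hf.mem (i - 1) (by omega)
      have h2 : (fun i => f (i - 1)) '' Set.Ico i (i + k)
          = (((Ico (i - 1) (i - 1 + k)).image f : Finset V) : Set V) := by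
        ext v
        simp only [Set.mem_image, Set.mem_Ico, coe_image, coe_Ico]
        constructor
        · rintro ⟨x, hx, rfl⟩
          exact ⟨x - 1, by omega, rfl⟩
        · rintro ⟨x, hx, rfl⟩
          exact ⟨x + 1, by omega, rfl⟩
      have h3 := (mem_filter.1 (hFD h1)).2
      rw [← h2] at h3
      exact h3
  · change Set.encard ((fun e : Finset V => (e : Set V)) '' (E : Set (Finset V))) = _
    rw [(coe_injective.injOn).encard_image, Set.encard_coe_eq_coe_finsetCard]

/-! ### Common neighbours in a random graph -/

theorem Nat.choose_div_pow_le_exp {m t : ℕ} {q : ℝ} (hq : 0 < q) (h : 8 * (m : ℝ) ≤ t * q) :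
    (m.choose t : ℝ) / q ^ t ≤ Real.exp (-t) := by
  have h1 : (m.choose t : ℝ) ≤ (m : ℝ) ^ t / (t.factorial : ℝ) := Nat.choose_le_pow_div t m
  have h2 : (m : ℝ) ^ t ≤ (t * q / 8) ^ t := by gcongr; linarith
  have h3 : (t : ℝ) ^ t / t.factorial ≤ Real.exp t :=
    Real.pow_div_factorial_le_exp (t : ℝ) (Nat.cast_nonneg t) t
  -- The constant `8` is there because `e ^ 2 < 8`.
  have h4 : Real.exp 1 / 8 ≤ Real.exp (-1) := by
    have := Real.exp_one_lt_d9
    rw [Real.exp_neg, div_le_iff₀ (by norm_num), inv_mul_eq_div, le_div_iff₀ (Real.exp_pos 1)]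
    nlinarith [Real.exp_pos 1]
  rw [div_le_iff₀ (by positivity)]
  calc (m.choose t : ℝ) ≤ (t * q / 8) ^ t / t.factorial := h1.trans (by gcongr)
    _ = (t : ℝ) ^ t / t.factorial * (q / 8) ^ t := by rw [mul_div_assoc, mul_pow]; ring
    _ ≤ Real.exp t * (q / 8) ^ t := by gcongr
    _ = (Real.exp 1 / 8) ^ t * q ^ t := by
        rw [← mul_one (t : ℝ), Real.exp_nat_mul, div_pow, div_pow]; ring
    _ ≤ Real.exp (-1) ^ t * q ^ t := by gcongr
    _ = Real.exp (-t) * q ^ t := by rw [← Real.exp_nat_mul]; simp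

open Finset in
theorem Fintype.card_forall_eq_zero {E : Type*} [Fintype E] [DecidableEq E] {Q : ℕ} [NeZero Q]
    (S : Finset E) :
    (#{ω : E → Fin Q | ∀ e ∈ S, ω e = 0} : ℝ) = (Q : ℝ) ^ Fintype.card E / (Q : ℝ) ^ #S := by
  have hQ : (Q : ℝ) ≠ 0 := Nat.cast_ne_zero.2 (NeZero.ne Q)
  have h1 : ({ω : E → Fin Q | ∀ e ∈ S, ω e = 0} : Finset (E → Fin Q))
      = Fintype.piFinset (fun e => if e ∈ S then {0} else univ) := by
    ext ω
    simp only [mem_filter, mem_univ, true_and, Fintype.mem_piFinset]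
    refine forall_congr' fun e => ?_
    by_cases he : e ∈ S <;> simp [he]
  have h2 : #{ω : E → Fin Q | ∀ e ∈ S, ω e = 0} = Q ^ #Sᶜ := by
    rw [h1, Fintype.card_piFinset, ← prod_mul_prod_compl S]
    rw [Finset.prod_congr rfl (g := fun _ => 1) (fun e he => by simp [he]), prod_const_one, one_mul,
      Finset.prod_congr rfl (g := fun _ => Q) (fun e he => by
        have : e ∉ S := by simpa using he
        simp [this]), prod_const]
  rw [h2, eq_div_iff (pow_ne_zero _ hQ), Nat.cast_pow, ← pow_add, card_compl_add_card]

open Finset in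
/-- Union bound over events which require at least `r` values to be zero. -/
theorem Fintype.card_exists_forall_eq_zero_le {E ι : Type*} [Fintype E] [DecidableEq E] {Q : ℕ}
    [NeZero Q] (I : Finset ι) (S : ι → Finset E) (r : ℕ) (hr : ∀ i ∈ I, #(S i) = r) :
    (#{ω : E → Fin Q | ∃ i ∈ I, ∀ e ∈ S i, ω e = 0} : ℝ)
      ≤ #I * ((Q : ℝ) ^ Fintype.card E / (Q : ℝ) ^ r) := by
  classical
  have h1 : ({ω : E → Fin Q | ∃ i ∈ I, ∀ e ∈ S i, ω e = 0} : Finset (E → Fin Q))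
      ⊆ I.biUnion fun i => ({ω : E → Fin Q | ∀ e ∈ S i, ω e = 0} : Finset (E → Fin Q)) := by
    intro ω
    simp
  have h2 := (card_le_card h1).trans card_biUnion_le
  calc (#{ω : E → Fin Q | ∃ i ∈ I, ∀ e ∈ S i, ω e = 0} : ℝ)
      ≤ ∑ i ∈ I, (#{ω : E → Fin Q | ∀ e ∈ S i, ω e = 0} : ℝ) := by exact_mod_cast h2
    _ = ∑ i ∈ I, ((Q : ℝ) ^ Fintype.card E / (Q : ℝ) ^ r) :=
        Finset.sum_congr rfl fun i hi => by rw [Fintype.card_forall_eq_zero, hr i hi]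
    _ = _ := by rw [sum_const, nsmul_eq_mul]

open Finset in
/-- The common neighbours of `s` outside of `s` in the graph whose edges are the pairs that `ω` maps
to zero. -/
def Finset.commonNbrs {V : Type*} [Fintype V] [DecidableEq V] {Q : ℕ} [NeZero Q]
    (ω : Sym2 V → Fin Q) (s : Finset V) : Finset V := {v | v ∉ s ∧ ∀ u ∈ s, ω s(u, v) = 0}

open Finset in
theorem Finset.mem_commonNbrs {V : Type*} [Fintype V] [DecidableEq V] {Q : ℕ} [NeZero Q]
    {ω : Sym2 V → Fin Q} {s : Finset V} {v : V} :
    v ∈ commonNbrs ω s ↔ v ∉ s ∧ ∀ u ∈ s, ω s(u, v) = 0 := by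
  simp [commonNbrs]

open Finset in
/-- The pairs joining `p.1` to `p.2` for `p ∈ T`. -/
def Finset.starPairs {V : Type*} [DecidableEq V] (T : Finset (Σ _ : Finset V, V)) :
    Finset (Sym2 V) := T.biUnion fun p => p.1.image fun u => s(u, p.2)

-- Stars with distinct indices share a pair only if they have the same centre and meeting leaf sets,
-- or if each centre is a leaf of the other. `hT` makes the first case trivial and `hc` excludes the
-- second.
open Finset in
theorem Finset.card_starPairs {V : Type*} [DecidableEq V] {T : Finset (Σ _ : Finset V, V)} {r : ℕ}
    (hr : ∀ p ∈ T, #p.1 = r)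
    (hT : ∀ p ∈ T, ∀ q ∈ T, ¬ Disjoint p.1 q.1 → p.1 = q.1)
    (hc : ∀ p ∈ T, ∀ q ∈ T, p.2 ∈ q.1 → q.2 ∉ p.1) : #(starPairs T) = #T * r := by
  have hdisj : (T : Set (Σ _ : Finset V, V)).PairwiseDisjoint
      fun p => p.1.image fun u => s(u, p.2) := by
    rintro ⟨β, v⟩ hp ⟨γ, w⟩ hq hpq
    rw [Function.onFun, disjoint_left]
    intro e he he'
    obtain ⟨x, hx, rfl⟩ := mem_image.1 he
    obtain ⟨y, hy, hxy⟩ := mem_image.1 he'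
    rcases Sym2.eq_iff.1 hxy with ⟨rfl, rfl⟩ | ⟨rfl, rfl⟩
    · obtain rfl : β = γ := hT _ hp _ hq fun h => disjoint_left.1 h hx hy
      exact hpq rfl
    · exact hc _ hp _ hq hy hx
  rw [starPairs, card_biUnion hdisj, sum_congr rfl (g := fun _ => r), sum_const, smul_eq_mul]
  intro p hp
  rw [card_image_of_injective, hr p hp]
  intro x y hxy
  exact Sym2.congr_left.1 hxy

open Finset in
/-- Among the pairs `(β, v)` with `v` a common neighbour of `β`, half have disjoint stars. -/
theorem Finset.exists_card_starPairs {V : Type*} [Fintype V] [DecidableEq V] {Q : ℕ} [NeZero Q]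
    {B : Finset (Finset V)} {C : Finset V} {r h : ℕ} (hr : ∀ β ∈ B, #β = r)
    (hB : (B : Set (Finset V)).PairwiseDisjoint id) {ω : Sym2 V → Fin Q}
    (hω : ∀ β ∈ B, 2 * h ≤ #(commonNbrs ω β ∩ C)) :
    ∃ T ∈ (B.sigma fun _ => C).powersetCard (#B * h), #(starPairs T) = #B * h * r ∧
      ∀ e ∈ starPairs T, ω e = 0 := by
  set T := B.sigma fun β => commonNbrs ω β ∩ C with hT
  have hTc : #B * (2 * h) ≤ #T := by
    rw [hT, card_sigma, ← smul_eq_mul]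
    exact card_nsmul_le_sum _ _ _ hω
  have hTm : ∀ p ∈ T, p.1 ∈ B ∧ p.2 ∈ commonNbrs ω p.1 ∧ p.2 ∈ C := by
    intro p hp
    rw [hT, mem_sigma, mem_inter] at hp
    exact hp
  have hBeq : ∀ β ∈ B, ∀ γ ∈ B, ∀ v, v ∈ β → v ∈ γ → β = γ := by
    intro β hβ γ hγ v hv hv'
    by_contra hne
    exact disjoint_left.1 (hB hβ hγ hne) hv hv'
  suffices H : ∃ T' ⊆ T, #B * h ≤ #T' ∧ ∀ p ∈ T', ∀ q ∈ T', p.2 ∈ q.1 → q.2 ∉ p.1 by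
    obtain ⟨T', hT', hcard, hc⟩ := H
    obtain ⟨U, hU, hUc⟩ := exists_subset_card_eq hcard
    refine ⟨U, mem_powersetCard.2 ⟨fun p hp => ?_, hUc⟩, ?_, ?_⟩
    · have := hTm p (hT' (hU hp))
      exact mem_sigma.2 ⟨this.1, this.2.2⟩
    · rw [card_starPairs (r := r) (fun p hp => hr _ (hTm p (hT' (hU hp))).1), hUc]
      · intro p hp q hq hpq
        rw [not_disjoint_iff] at hpq
        obtain ⟨v, hv, hv'⟩ := hpq
        exact hBeq _ (hTm p (hT' (hU hp))).1 _ (hTm q (hT' (hU hq))).1 v hv hv'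
      · exact fun p hp q hq => hc p (hU hp) q (hU hq)
    · intro e he
      obtain ⟨p, hp, he⟩ := mem_biUnion.1 he
      obtain ⟨u, hu, rfl⟩ := mem_image.1 he
      exact (mem_commonNbrs.1 (hTm p (hT' (hU hp))).2.1).2 u hu
  -- Order the sets by `φ` and split `T` by whether the centre lies in a member of `B` earlier than
  -- its own leaf set. Two crossing stars in the same class would require each leaf set to precede
  -- the other, or the two to coincide, which is impossible as a centre is outside its leaf set. The
  -- larger class has at least half of `T`.
  let φ := Fintype.equivFin (Finset V)
  let P : (Σ _ : Finset V, V) → Prop := fun p => ∃ β ∈ B, p.2 ∈ β ∧ φ β < φ p.1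
  classical
  have hsum := card_filter_add_card_filter_not (s := T) P
  have hor : #B * h ≤ #(T.filter P) ∨ #B * h ≤ #(T.filter fun p => ¬ P p) := by
    have : #B * (2 * h) = 2 * (#B * h) := by ring
    omega
  rcases hor with hor | hor
  · refine ⟨_, filter_subset _ _, hor, ?_⟩
    intro p hp q hq hpq hqp
    rw [mem_filter] at hp hq
    obtain ⟨β, hβ, hpβ, h1⟩ := hp.2
    obtain ⟨γ, hγ, hqγ, h2⟩ := hq.2
    rw [hBeq β hβ _ (hTm q hq.1).1 _ hpβ hpq] at h1
    rw [hBeq γ hγ _ (hTm p hp.1).1 _ hqγ hqp] at h2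
    exact lt_asymm h1 h2
  · refine ⟨_, filter_subset _ _, hor, ?_⟩
    intro p hp q hq hpq hqp
    rw [mem_filter] at hp hq
    have h1 : ¬ φ q.1 < φ p.1 := fun h => hp.2 ⟨_, (hTm q hq.1).1, hpq, h⟩
    have h2 : ¬ φ p.1 < φ q.1 := fun h => hq.2 ⟨_, (hTm p hp.1).1, hqp, h⟩
    have h3 : p.1 = q.1 := φ.injective (le_antisymm (not_lt.1 h1) (not_lt.1 h2))
    rw [← h3] at hpq
    exact (mem_commonNbrs.1 (hTm p hp.1).2.1).1 hpq

open Finset in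
/-- It is unlikely that all members of a disjoint family have many common neighbours in `C`. -/
theorem Finset.card_forall_le_commonNbrs_le {V : Type*} [Fintype V] [DecidableEq V] {Q : ℕ}
    [NeZero Q] {B : Finset (Finset V)} {C : Finset V} {r h : ℕ} (hr : ∀ β ∈ B, #β = r)
    (hB : (B : Set (Finset V)).PairwiseDisjoint id) (hC : 8 * #C ≤ h * Q ^ r) :
    (#{ω : Sym2 V → Fin Q | ∀ β ∈ B, 2 * h ≤ #(commonNbrs ω β ∩ C)} : ℝ)
      ≤ (Q : ℝ) ^ Fintype.card (Sym2 V) * Real.exp (-(#B * h : ℕ)) := by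
  classical
  have hQ : 0 < (Q : ℝ) := Nat.cast_pos.2 (NeZero.pos Q)
  set I := ((B.sigma fun _ => C).powersetCard (#B * h)).filter
    fun T => #(starPairs T) = #B * h * r with hI
  have h1 : ({ω : Sym2 V → Fin Q | ∀ β ∈ B, 2 * h ≤ #(commonNbrs ω β ∩ C)} : Finset _)
      ⊆ ({ω : Sym2 V → Fin Q | ∃ T ∈ I, ∀ e ∈ starPairs T, ω e = 0} : Finset _) := by
    intro ω hω
    rw [mem_filter] at hω ⊢
    obtain ⟨T, hT, hT', hT''⟩ := exists_card_starPairs hr hB hω.2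
    exact ⟨mem_univ _, T, mem_filter.2 ⟨hT, hT'⟩, hT''⟩
  have h2 := Fintype.card_exists_forall_eq_zero_le (Q := Q) I starPairs (#B * h * r)
    fun T hT => (mem_filter.1 hT).2
  have h3 : #I ≤ (#B * #C).choose (#B * h) := by
    refine (card_filter_le _ _).trans ?_
    rw [card_powersetCard, card_sigma, sum_const, smul_eq_mul]
  have h4 : ((#B * #C).choose (#B * h) : ℝ) / ((Q : ℝ) ^ r) ^ (#B * h)
      ≤ Real.exp (-(#B * h : ℕ)) := by
    apply Nat.choose_div_pow_le_exp (by positivity)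
    have : 8 * (#B * #C) ≤ #B * h * Q ^ r := by
      calc 8 * (#B * #C) = #B * (8 * #C) := by ring
        _ ≤ #B * (h * Q ^ r) := by gcongr
        _ = _ := by ring
    exact_mod_cast this
  calc (#{ω : Sym2 V → Fin Q | ∀ β ∈ B, 2 * h ≤ #(commonNbrs ω β ∩ C)} : ℝ)
      ≤ #{ω : Sym2 V → Fin Q | ∃ T ∈ I, ∀ e ∈ starPairs T, ω e = 0} := by
        exact_mod_cast card_le_card h1
    _ ≤ #I * ((Q : ℝ) ^ Fintype.card (Sym2 V) / (Q : ℝ) ^ (#B * h * r)) := h2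
    _ ≤ (#B * #C).choose (#B * h)
          * ((Q : ℝ) ^ Fintype.card (Sym2 V) / (Q : ℝ) ^ (#B * h * r)) := by gcongr
    _ = (Q : ℝ) ^ Fintype.card (Sym2 V)
          * (((#B * #C).choose (#B * h) : ℝ) / ((Q : ℝ) ^ r) ^ (#B * h)) := by
        rw [← pow_mul, mul_comm r]; ring
    _ ≤ _ := by gcongr

/-! ### Cliques and union bounds -/

open Finset in
/-- The cliques with `j` vertices of the graph whose edges are the pairs that `ω` maps to zero. -/
def Finset.zeroCliques {V : Type*} [Fintype V] [DecidableEq V] {Q : ℕ} [NeZero Q]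
    (ω : Sym2 V → Fin Q) (j : ℕ) : Finset (Finset V) :=
  {s ∈ univ.powersetCard j | ∀ e ∈ s.offDiag.image Sym2.mk.uncurry, ω e = 0}

open Finset in
theorem Finset.mem_zeroCliques {V : Type*} [Fintype V] [DecidableEq V] {Q : ℕ} [NeZero Q]
    {ω : Sym2 V → Fin Q} {j : ℕ} {s : Finset V} :
    s ∈ zeroCliques ω j ↔ #s = j ∧ ∀ u ∈ s, ∀ v ∈ s, u ≠ v → ω s(u, v) = 0 := by
  rw [zeroCliques, mem_filter, mem_powersetCard_univ]
  refine and_congr_right fun _ => ⟨fun h u hu v hv huv => ?_, fun h e he => ?_⟩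
  · exact h _ (mem_image.2 ⟨(u, v), mem_offDiag.2 ⟨hu, hv, huv⟩, rfl⟩)
  · obtain ⟨⟨u, v⟩, hp, rfl⟩ := mem_image.1 he
    obtain ⟨hu, hv, huv⟩ := mem_offDiag.1 hp
    exact h u hu v hv huv

open Finset in
theorem Finset.sum_card_zeroCliques (V : Type*) [Fintype V] [DecidableEq V] (Q : ℕ) [NeZero Q]
    (j : ℕ) : (∑ ω : Sym2 V → Fin Q, (#(zeroCliques ω j) : ℝ))
      = (Fintype.card V).choose j * ((Q : ℝ) ^ Fintype.card (Sym2 V) / (Q : ℝ) ^ j.choose 2) := by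
  calc (∑ ω : Sym2 V → Fin Q, (#(zeroCliques ω j) : ℝ))
      = ∑ ω : Sym2 V → Fin Q, ∑ s ∈ univ.powersetCard j,
          if ∀ e ∈ s.offDiag.image Sym2.mk.uncurry, ω e = 0 then (1 : ℝ) else 0 := by
        refine sum_congr rfl fun ω _ => ?_
        rw [zeroCliques, card_filter]
        push_cast
        rfl
    _ = ∑ s ∈ (univ : Finset V).powersetCard j,
          (#{ω : Sym2 V → Fin Q | ∀ e ∈ s.offDiag.image Sym2.mk.uncurry, ω e = 0} : ℝ) := by
        rw [sum_comm]
        refine sum_congr rfl fun s _ => ?_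
        rw [card_filter]
        push_cast
        rfl
    _ = ∑ s ∈ (univ : Finset V).powersetCard j,
          ((Q : ℝ) ^ Fintype.card (Sym2 V) / (Q : ℝ) ^ j.choose 2) := by
        refine sum_congr rfl fun s hs => ?_
        rw [Fintype.card_forall_eq_zero, Sym2.card_image_offDiag, (mem_powersetCard.1 hs).2]
    _ = _ := by rw [sum_const, card_powersetCard, card_univ, nsmul_eq_mul]

open Finset in
theorem Finset.zeroCliques_shadow {V : Type*} [Fintype V] [DecidableEq V] {Q : ℕ} [NeZero Q]
    (ω : Sym2 V → Fin Q) (k : ℕ) : (zeroCliques ω k).shadow ⊆ zeroCliques ω (k - 1) := by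
  intro s hs
  obtain ⟨e, he, a, ha, rfl⟩ := mem_shadow_iff.1 hs
  rw [mem_zeroCliques] at he ⊢
  exact ⟨by rw [card_erase_of_mem ha, he.1], fun u hu v hv =>
    he.2 u (mem_of_mem_erase hu) v (mem_of_mem_erase hv)⟩

open Finset in
theorem Finset.extensions_zeroCliques_subset {V : Type*} [Fintype V] [DecidableEq V] {Q : ℕ}
    [NeZero Q] (ω : Sym2 V → Fin Q) (k : ℕ) (s : Finset V) :
    (zeroCliques ω k).extensions s ⊆ commonNbrs ω s := by
  intro v hv
  rw [mem_extensions, mem_zeroCliques] at hv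
  refine mem_commonNbrs.2 ⟨hv.1, fun u hu => hv.2.2 u (mem_insert_of_mem hu) v
    (mem_insert_self _ _) ?_⟩
  rintro rfl
  exact hv.1 hu

open Finset in
theorem Finset.card_zeroCliques_succ_le {V : Type*} [Fintype V] [DecidableEq V] {Q : ℕ} [NeZero Q]
    {ω : Sym2 V → Fin Q} {j t : ℕ} (h : ∀ s : Finset V, #s = j → #(commonNbrs ω s) ≤ t) :
    #(zeroCliques ω (j + 1)) ≤ #(zeroCliques ω j) * t := by
  have hsub : zeroCliques ω (j + 1) ⊆
      (zeroCliques ω j).biUnion fun s => (commonNbrs ω s).image fun v => insert v s := by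
    intro e he
    obtain ⟨a, ha⟩ : e.Nonempty := card_pos.1 (by rw [(mem_zeroCliques.1 he).1]; omega)
    have hs : e.erase a ∈ zeroCliques ω j := zeroCliques_shadow ω (j + 1) (erase_mem_shadow he ha)
    refine mem_biUnion.2 ⟨_, hs, mem_image.2 ⟨a, ?_, insert_erase ha⟩⟩
    apply extensions_zeroCliques_subset ω (j + 1)
    rw [mem_extensions, insert_erase ha]
    exact ⟨notMem_erase a e, he⟩
  exact (card_le_card hsub).trans (card_biUnion_le_card_mul _ _ _ fun s hs =>
    card_image_le.trans (h s (mem_zeroCliques.1 hs).1))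

open Finset in
theorem Finset.card_zeroCliques_le_prod {V : Type*} [Fintype V] [DecidableEq V] {Q : ℕ} [NeZero Q]
    {ω : Sym2 V → Fin Q} {k : ℕ} {t : ℕ → ℕ}
    (h : ∀ j ∈ Ico 1 k, ∀ s : Finset V, #s = j → #(commonNbrs ω s) ≤ t j) (hk : 1 ≤ k) :
    #(zeroCliques ω k) ≤ Fintype.card V * ∏ j ∈ Ico 1 k, t j := by
  induction k, hk using Nat.le_induction with
  | base =>
    simp only [Ico_self, prod_empty, mul_one]
    refine (card_filter_le _ _).trans ?_
    rw [card_powersetCard, card_univ, Nat.choose_one_right]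
  | succ k hk ih =>
    rw [prod_Ico_succ_top hk, ← mul_assoc]
    refine (card_zeroCliques_succ_le (h k (by simp; omega))).trans ?_
    gcongr
    exact ih fun j hj => h j (by simp at hj ⊢; omega)

-- The estimate for disjoint families, applied to `B = {s}` and `C = univ` and summed over at most
-- `N ^ j` sets `s`.
open Finset in
theorem Finset.card_exists_commonNbrs_ge_le (V : Type*) [Fintype V] [DecidableEq V] {Q : ℕ}
    [NeZero Q] {j h : ℕ} (hh : 8 * Fintype.card V ≤ h * Q ^ j) :
    (#{ω : Sym2 V → Fin Q | ∃ s : Finset V, #s = j ∧ 2 * h ≤ #(commonNbrs ω s)} : ℝ)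
      ≤ (Q : ℝ) ^ Fintype.card (Sym2 V) * ((Fintype.card V : ℝ) ^ j * Real.exp (-(h : ℕ))) := by
  classical
  have h1 : ({ω : Sym2 V → Fin Q | ∃ s : Finset V, #s = j ∧ 2 * h ≤ #(commonNbrs ω s)} : Finset _)
      ⊆ ((univ : Finset V).powersetCard j).biUnion fun s =>
        ({ω : Sym2 V → Fin Q | ∀ β ∈ ({s} : Finset (Finset V)),
          2 * h ≤ #(commonNbrs ω β ∩ univ)} : Finset _) := by
    intro ω hω
    obtain ⟨s, hs, hs'⟩ := (mem_filter.1 hω).2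
    refine mem_biUnion.2 ⟨s, mem_powersetCard_univ.2 hs, ?_⟩
    simpa using hs'
  calc (#{ω : Sym2 V → Fin Q | ∃ s : Finset V, #s = j ∧ 2 * h ≤ #(commonNbrs ω s)} : ℝ)
      ≤ ∑ s ∈ (univ : Finset V).powersetCard j,
        (#{ω : Sym2 V → Fin Q | ∀ β ∈ ({s} : Finset (Finset V)),
          2 * h ≤ #(commonNbrs ω β ∩ univ)} : ℝ) := by
        exact_mod_cast (card_le_card h1).trans card_biUnion_le
    _ ≤ ∑ s ∈ (univ : Finset V).powersetCard j,
        ((Q : ℝ) ^ Fintype.card (Sym2 V) * Real.exp (-(h : ℕ))) := by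
        refine sum_le_sum fun s hs => ?_
        have := card_forall_le_commonNbrs_le (Q := Q) (B := {s}) (C := univ) (r := j) (h := h)
          (by simpa using hs) (by simp) (by simpa using hh)
        simpa using this
    _ = ((Fintype.card V).choose j : ℝ)
          * ((Q : ℝ) ^ Fintype.card (Sym2 V) * Real.exp (-(h : ℕ))) := by
        rw [sum_const, card_powersetCard, card_univ, nsmul_eq_mul]
    _ ≤ (Fintype.card V : ℝ) ^ j * ((Q : ℝ) ^ Fintype.card (Sym2 V) * Real.exp (-(h : ℕ))) := by
        gcongr
        exact_mod_cast Nat.choose_le_pow _ _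
    _ = _ := by ring

open Finset Classical in
theorem Finset.card_exists_family_le (V : Type*) [Fintype V] [DecidableEq V] {Q : ℕ} [NeZero Q]
    {r b c h : ℕ} (hc : c ≤ Fintype.card V) (hh : 8 * c ≤ h * Q ^ r) :
    (#{ω : Sym2 V → Fin Q | ∃ (B : Finset (Finset V)) (C : Finset V), #B = b ∧ (∀ β ∈ B, #β = r) ∧
        (B : Set (Finset V)).PairwiseDisjoint id ∧ #C ≤ c ∧
        ∀ β ∈ B, 2 * h ≤ #(commonNbrs ω β ∩ C)} : ℝ)
      ≤ (Q : ℝ) ^ Fintype.card (Sym2 V)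
        * ((Fintype.card V : ℝ) ^ (r * b + c) * Real.exp (-(b * h : ℕ))) := by
  set N := Fintype.card V with hN
  set I := (((univ : Finset V).powersetCard r).powersetCard b).filter
    (fun B : Finset (Finset V) => (B : Set (Finset V)).PairwiseDisjoint id) ×ˢ (univ : Finset V).powersetCard c with hI
  have hIc : #I ≤ N ^ (r * b + c) := by
    rw [hI, card_product, pow_add]
    gcongr
    · refine (card_filter_le _ _).trans ?_
      rw [card_powersetCard, card_powersetCard, card_univ, pow_mul]
      exact (Nat.choose_le_pow _ _).trans (Nat.pow_le_pow_left (Nat.choose_le_pow _ _) _)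
    · rw [card_powersetCard, card_univ]
      exact Nat.choose_le_pow _ _
  set A := ({ω : Sym2 V → Fin Q | ∃ (B : Finset (Finset V)) (C : Finset V), #B = b ∧
    (∀ β ∈ B, #β = r) ∧ (B : Set (Finset V)).PairwiseDisjoint id ∧ #C ≤ c ∧
    ∀ β ∈ B, 2 * h ≤ #(commonNbrs ω β ∩ C)} : Finset (Sym2 V → Fin Q)) with hA
  have h1 : A ⊆ I.biUnion fun p => ({ω : Sym2 V → Fin Q | ∀ β ∈ p.1,
      2 * h ≤ #(commonNbrs ω β ∩ p.2)} : Finset _) := by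
    intro ω hω
    obtain ⟨B, C, hB, hBr, hBd, hC, hBC⟩ := (mem_filter.1 hω).2
    -- Enlarging `C` to exactly `c` vertices preserves the event, so only `N ^ c` sets need be
    -- counted.
    obtain ⟨C', hCC', -, hC'⟩ := exists_subsuperset_card_eq (subset_univ C) hC
      (by rwa [card_univ])
    refine mem_biUnion.2 ⟨(B, C'), ?_, mem_filter.2 ⟨mem_univ _, fun β hβ => ?_⟩⟩
    · rw [hI, mem_product, mem_filter, mem_powersetCard, mem_powersetCard_univ]
      exact ⟨⟨⟨fun β hβ => mem_powersetCard_univ.2 (hBr β hβ), hB⟩, hBd⟩, hC'⟩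
    · exact (hBC β hβ).trans (card_le_card (inter_subset_inter_left hCC'))
  calc (#A : ℝ) ≤ ∑ p ∈ I, (#{ω : Sym2 V → Fin Q | ∀ β ∈ p.1,
      2 * h ≤ #(commonNbrs ω β ∩ p.2)} : ℝ) := by
        exact_mod_cast (card_le_card h1).trans card_biUnion_le
    _ ≤ ∑ p ∈ I, ((Q : ℝ) ^ Fintype.card (Sym2 V) * Real.exp (-(b * h : ℕ))) := by
        refine sum_le_sum fun p hp => ?_
        rw [hI, mem_product, mem_filter, mem_powersetCard, mem_powersetCard_univ] at hp
        obtain ⟨⟨⟨hpr, hpb⟩, hpd⟩, hpc⟩ := hp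
        have := card_forall_le_commonNbrs_le (Q := Q) (B := p.1) (C := p.2) (r := r) (h := h)
          (fun β hβ => mem_powersetCard_univ.1 (hpr hβ)) hpd (by rwa [hpc])
        rwa [hpb] at this
    _ = #I * ((Q : ℝ) ^ Fintype.card (Sym2 V) * Real.exp (-(b * h : ℕ))) := by
        rw [sum_const, nsmul_eq_mul]
    _ ≤ (N : ℝ) ^ (r * b + c) * ((Q : ℝ) ^ Fintype.card (Sym2 V) * Real.exp (-(b * h : ℕ))) := by
        gcongr
        exact_mod_cast hIc
    _ = _ := by ring

open Finset in
/-- The bound on the expected number of `(k - 1)`-cliques in terms of that of `k`-cliques. -/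
theorem Nat.choose_div_pow_le {N Q k h : ℕ} (hQ : 0 < Q) (hk : 1 ≤ k)
    (hN : 8 * h * k * Q ^ (k - 1) + k ≤ N + 1) :
    4 * (h : ℝ) * (N.choose (k - 1) / (Q : ℝ) ^ (k - 1).choose 2)
      ≤ (N.choose k / (Q : ℝ) ^ k.choose 2) / 2 := by
  obtain ⟨m, rfl⟩ : ∃ m, k = m + 1 := ⟨k - 1, by omega⟩
  simp only [Nat.add_sub_cancel] at hN ⊢
  have hQ' : 0 < (Q : ℝ) := Nat.cast_pos.2 hQ
  have h1 : 8 * h * Q ^ m * N.choose m ≤ N.choose (m + 1) := by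
    have h2 : 8 * h * (m + 1) * Q ^ m ≤ N - m := by omega
    refine Nat.le_of_mul_le_mul_right ?_ (Nat.succ_pos m)
    rw [Nat.succ_eq_add_one, Nat.choose_succ_right_eq]
    calc 8 * h * Q ^ m * N.choose m * (m + 1) = N.choose m * (8 * h * (m + 1) * Q ^ m) := by ring
      _ ≤ N.choose m * (N - m) := by gcongr
  have h3 : (8 * h * (Q : ℝ) ^ m * N.choose m) ≤ N.choose (m + 1) := by exact_mod_cast h1
  have h4 : (m + 1).choose 2 = m + m.choose 2 := by
    rw [Nat.choose_succ_succ' m 1, Nat.choose_one_right]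
  rw [h4, pow_add]
  calc 4 * (h : ℝ) * (N.choose m / (Q : ℝ) ^ m.choose 2)
      = (8 * h * (Q : ℝ) ^ m * N.choose m) / ((Q : ℝ) ^ m * (Q : ℝ) ^ m.choose 2) / 2 := by
        field_simp; ring
    _ ≤ _ := by gcongr

-- First moment argument. By `hp`, the failures of expansion or of the codegree bounds have
-- probability below `1 / (2 * Q ^ k.choose 2)`. As there are never more than `N.choose k`
-- `k`-cliques, failures contribute less than half of their expected number; the other half still
-- exceeds the expected `4h`-fold count of `(k - 1)`-cliques.
open Finset in
theorem Finset.exists_zeroCliques {V : Type*} [Fintype V] [DecidableEq V] {Q : ℕ} [NeZero Q]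
    {k n h : ℕ} {g : ℕ → ℕ} (hk : 1 ≤ k) (hn : 1 ≤ n) (hh : 16 * k * n ≤ h * Q ^ (k - 1))
    (hN : 8 * h * k * Q ^ (k - 1) + k ≤ Fintype.card V + 1) (hkn : 2 * k * n ≤ Fintype.card V)
    (hg : ∀ j ∈ Ico 1 k, 8 * Fintype.card V ≤ g j * Q ^ j)
    (hp : ∑ b ∈ Icc 1 n,
        (Fintype.card V : ℝ) ^ ((k - 1) * b + 2 * k * b) * Real.exp (-(b * h : ℕ))
      + ∑ j ∈ Ico 1 k, (Fintype.card V : ℝ) ^ j * Real.exp (-(g j : ℕ))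
      < 1 / (2 * (Q : ℝ) ^ k.choose 2)) :
    ∃ ω : Sym2 V → Fin Q, 2 * (2 * h) * #(zeroCliques ω (k - 1)) < #(zeroCliques ω k) ∧
      (∀ (B : Finset (Finset V)) (C : Finset V), B.Nonempty → #B ≤ n →
        (∀ β ∈ B, #β = k - 1) → (B : Set (Finset V)).PairwiseDisjoint id → #C ≤ 2 * k * #B →
        ∃ β ∈ B, #(commonNbrs ω β ∩ C) < 2 * h) ∧
      ∀ j ∈ Ico 1 k, ∀ s : Finset V, #s = j → #(commonNbrs ω s) ≤ 2 * g j := by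
  classical
  set N := Fintype.card V with hNdef
  have hQ : 0 < (Q : ℝ) := Nat.cast_pos.2 (NeZero.pos Q)
  set Ω : ℝ := (Q : ℝ) ^ Fintype.card (Sym2 V) with hΩ
  have hΩ0 : 0 < Ω := by positivity
  let X : ℕ → Finset (Sym2 V → Fin Q) := fun b =>
    {ω | ∃ (B : Finset (Finset V)) (C : Finset V), #B = b ∧ (∀ β ∈ B, #β = k - 1) ∧
      (B : Set (Finset V)).PairwiseDisjoint id ∧ #C ≤ 2 * k * b ∧
      ∀ β ∈ B, 2 * h ≤ #(commonNbrs ω β ∩ C)}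
  let Y : ℕ → Finset (Sym2 V → Fin Q) := fun j =>
    {ω | ∃ s : Finset V, #s = j ∧ 2 * g j ≤ #(commonNbrs ω s)}
  set bad := (Icc 1 n).biUnion X ∪ (Ico 1 k).biUnion Y with hbad
  have hX : ∀ b ∈ Icc 1 n, (#(X b) : ℝ)
      ≤ Ω * ((N : ℝ) ^ ((k - 1) * b + 2 * k * b) * Real.exp (-(b * h : ℕ))) := by
    intro b hb
    rw [mem_Icc] at hb
    have hle : 2 * k * b ≤ 2 * k * n := Nat.mul_le_mul_left _ hb.2
    refine le_of_eq_of_le ?_ (card_exists_family_le V (Q := Q) (r := k - 1) (b := b)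
      (c := 2 * k * b) (h := h) (hle.trans hkn) ?_)
    · congr!
    · calc 8 * (2 * k * b) ≤ 8 * (2 * k * n) := by gcongr
        _ = 16 * k * n := by ring
        _ ≤ _ := hh
  have hY : ∀ j ∈ Ico 1 k, (#(Y j) : ℝ) ≤ Ω * ((N : ℝ) ^ j * Real.exp (-(g j : ℕ))) := by
    intro j hj
    refine le_of_eq_of_le ?_ (card_exists_commonNbrs_ge_le V (Q := Q) (j := j) (hg j hj))
    congr!
  have hbadc : (#bad : ℝ) < Ω * (1 / (2 * (Q : ℝ) ^ k.choose 2)) := by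
    calc (#bad : ℝ) ≤ ∑ b ∈ Icc 1 n, (#(X b) : ℝ) + ∑ j ∈ Ico 1 k, (#(Y j) : ℝ) := by
          exact_mod_cast (card_union_le _ _).trans (add_le_add card_biUnion_le card_biUnion_le)
      _ ≤ _ := add_le_add (sum_le_sum hX) (sum_le_sum hY)
      _ = _ := by rw [← mul_sum, ← mul_sum, ← mul_add]
      _ < _ := by gcongr
  have hgood : ∃ ω, ω ∉ bad ∧ 2 * (2 * h) * #(zeroCliques ω (k - 1)) < #(zeroCliques ω k) := by
    by_contra! hcon
    -- If no good `ω` had enough `k`-cliques, summing this pointwise bound would contradict the two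
    -- expectations.
    have hpoint : ∀ ω : Sym2 V → Fin Q, (#(zeroCliques ω k) : ℝ)
        ≤ 4 * h * #(zeroCliques ω (k - 1)) + if ω ∈ bad then (N.choose k : ℝ) else 0 := by
      intro ω
      split_ifs with hω
      · have h1 : #(zeroCliques ω k) ≤ N.choose k := by
          refine (card_filter_le _ _).trans ?_
          rw [card_powersetCard, card_univ]
        have h2 : (#(zeroCliques ω k) : ℝ) ≤ N.choose k := by exact_mod_cast h1
        have h3 : (0 : ℝ) ≤ 4 * h * #(zeroCliques ω (k - 1)) := by positivity
        linarith
      · have h1 : (#(zeroCliques ω k) : ℝ) ≤ 2 * (2 * h) * #(zeroCliques ω (k - 1)) := by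
          exact_mod_cast hcon ω hω
        linarith
    have hsum := sum_le_sum fun ω (_ : ω ∈ univ) => hpoint ω
    rw [sum_add_distrib, ← mul_sum, sum_card_zeroCliques, sum_card_zeroCliques, sum_ite_mem,
      univ_inter, sum_const, nsmul_eq_mul] at hsum
    have h1 := Nat.choose_div_pow_le (NeZero.pos Q) hk hN
    have hc : 0 < (N.choose k : ℝ) := by
      refine Nat.cast_pos.2 (Nat.choose_pos ?_)
      calc k ≤ k * (2 * n) := Nat.le_mul_of_pos_right k (by omega)
        _ = 2 * k * n := by ring
        _ ≤ N := hkn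
    have h2 : (#bad : ℝ) * N.choose k < Ω * (1 / (2 * (Q : ℝ) ^ k.choose 2)) * N.choose k := by
      gcongr
    have h3 := mul_le_mul_of_nonneg_left h1 hΩ0.le
    have e1 : Ω * (4 * (h : ℝ) * (N.choose (k - 1) / (Q : ℝ) ^ (k - 1).choose 2))
      = 4 * h * (N.choose (k - 1) * (Ω / (Q : ℝ) ^ (k - 1).choose 2)) := by ring
    have e2 : Ω * ((N.choose k / (Q : ℝ) ^ k.choose 2) / 2)
      = (N.choose k * (Ω / (Q : ℝ) ^ k.choose 2)) / 2 := by ring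
    have e3 : Ω * (1 / (2 * (Q : ℝ) ^ k.choose 2)) * N.choose k
      = (N.choose k * (Ω / (Q : ℝ) ^ k.choose 2)) / 2 := by field_simp
    linarith
  obtain ⟨ω, hω, hlt⟩ := hgood
  rw [hbad, mem_union, not_or, mem_biUnion, mem_biUnion] at hω
  refine ⟨ω, hlt, ?_, ?_⟩
  · intro B C hB hBn hBr hBd hC
    by_contra! hcon
    exact hω.1 ⟨#B, mem_Icc.2 ⟨hB.card_pos, hBn⟩,
      mem_filter.2 ⟨mem_univ _, B, C, rfl, hBr, hBd, hC, hcon⟩⟩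
  · intro j hj s hs
    by_contra! hcon
    exact hω.2 ⟨j, hj, mem_filter.2 ⟨mem_univ _, s, hs, hcon.le⟩⟩

/-! ### Choice of parameters -/

theorem Real.natCast_pow_mul_exp_neg_le {N a m : ℕ} {x : ℝ} (hN : 0 < N)
    (hx : ((a + m : ℕ) : ℝ) * Real.log N ≤ x) :
    (N : ℝ) ^ a * Real.exp (-x) ≤ 1 / (N : ℝ) ^ m := by
  have hN' : 0 < (N : ℝ) := Nat.cast_pos.2 hN
  have h1 : Real.exp (-x) ≤ 1 / (N : ℝ) ^ (a + m) := by
    calc Real.exp (-x) ≤ Real.exp (-(((a + m : ℕ) : ℝ) * Real.log N)) := by gcongr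
      _ = 1 / (N : ℝ) ^ (a + m) := by
        rw [Real.exp_neg, Real.exp_nat_mul, Real.exp_log hN', one_div]
  calc (N : ℝ) ^ a * Real.exp (-x) ≤ (N : ℝ) ^ a * (1 / (N : ℝ) ^ (a + m)) := by gcongr
    _ = 1 / (N : ℝ) ^ m := by rw [pow_add]; field_simp

-- In `k ^ 2 + 3 * k + 10`, the `3 * k` absorbs the number of choices of `B` and `C` (per member of
-- `B`), the `k ^ 2` beats `Q ^ k.choose 2`, and the `10` pays for summing at most `2 * N` terms and
-- for the factor `1 / 2`.
open Finset in
theorem sum_failure_probability_lt {N Q k n h : ℕ} {g : ℕ → ℕ} (hQ : 0 < Q) (hQN : Q ≤ N)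
    (hN : 2 ≤ N) (hkN : k ≤ N) (hnN : n ≤ N)
    (hh : ((k ^ 2 + 3 * k + 10 : ℕ) : ℝ) * Real.log N ≤ h)
    (hg : ∀ j ∈ Ico 1 k, ((k ^ 2 + 3 * k + 10 : ℕ) : ℝ) * Real.log N ≤ g j) :
    ∑ b ∈ Icc 1 n, (N : ℝ) ^ ((k - 1) * b + 2 * k * b) * Real.exp (-(b * h : ℕ))
      + ∑ j ∈ Ico 1 k, (N : ℝ) ^ j * Real.exp (-(g j : ℕ)) < 1 / (2 * (Q : ℝ) ^ k.choose 2) := by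
  have hN0 : 0 < N := by omega
  have hN' : 0 < (N : ℝ) := Nat.cast_pos.2 hN0
  have hlog : 0 ≤ Real.log N := Real.log_natCast_nonneg N
  have h1 : ∀ b ∈ Icc 1 n, (N : ℝ) ^ ((k - 1) * b + 2 * k * b) * Real.exp (-(b * h : ℕ))
      ≤ 1 / (N : ℝ) ^ (k ^ 2 + 10) := by
    intro b hb
    have hb1 := (mem_Icc.1 hb).1
    apply Real.natCast_pow_mul_exp_neg_le hN0
    have : (k - 1) * b + 2 * k * b + (k ^ 2 + 10) ≤ b * (k ^ 2 + 3 * k + 10) := by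
      have h2 : (k - 1) * b ≤ k * b := Nat.mul_le_mul_right _ (Nat.sub_le _ _)
      nlinarith
    calc (((k - 1) * b + 2 * k * b + (k ^ 2 + 10) : ℕ) : ℝ) * Real.log N
        ≤ ((b * (k ^ 2 + 3 * k + 10) : ℕ) : ℝ) * Real.log N := by gcongr
      _ = b * (((k ^ 2 + 3 * k + 10 : ℕ) : ℝ) * Real.log N) := by push_cast; ring
      _ ≤ b * h := by gcongr
      _ = _ := by push_cast; ring
  have h2 : ∀ j ∈ Ico 1 k, (N : ℝ) ^ j * Real.exp (-(g j : ℕ)) ≤ 1 / (N : ℝ) ^ (k ^ 2 + 10) := by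
    intro j hj
    have hj1 := (mem_Ico.1 hj).2
    apply Real.natCast_pow_mul_exp_neg_le hN0
    refine le_trans (mul_le_mul_of_nonneg_right (Nat.cast_le.2 ?_) hlog) (hg j hj)
    omega
  have h3 := sum_le_card_nsmul _ _ _ h1
  have h4 := sum_le_card_nsmul _ _ _ h2
  rw [nsmul_eq_mul, Nat.card_Icc, Nat.add_sub_cancel] at h3
  rw [nsmul_eq_mul, Nat.card_Ico] at h4
  have h5 : ((k - 1 : ℕ) : ℝ) ≤ N := by exact_mod_cast (Nat.sub_le _ _).trans hkN
  have h6 : (n : ℝ) ≤ N := by exact_mod_cast hnN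
  have h7 : (Q : ℝ) ^ k.choose 2 ≤ (N : ℝ) ^ k ^ 2 := by
    have h8 : (Q : ℝ) ≤ N := by exact_mod_cast hQN
    have h9 : (1 : ℝ) ≤ N := by exact_mod_cast hN0
    calc (Q : ℝ) ^ k.choose 2 ≤ (N : ℝ) ^ k.choose 2 := by gcongr
      _ ≤ (N : ℝ) ^ k ^ 2 := pow_le_pow_right₀ h9 (Nat.choose_le_pow k 2)
  have hQ' : 0 < (Q : ℝ) := Nat.cast_pos.2 hQ
  have h2N : (2 : ℝ) ≤ N := by exact_mod_cast hN
  have h10 : (N : ℝ) ^ (k ^ 2 + 10) = (N : ℝ) ^ k ^ 2 * N ^ 10 := pow_add _ _ _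
  have h11 : (2 : ℝ) ^ 9 ≤ (N : ℝ) ^ 9 := by gcongr
  calc _ ≤ (n : ℝ) * (1 / (N : ℝ) ^ (k ^ 2 + 10))
        + ((k - 1 : ℕ) : ℝ) * (1 / (N : ℝ) ^ (k ^ 2 + 10)) := add_le_add h3 h4
    _ ≤ (N : ℝ) * (1 / (N : ℝ) ^ (k ^ 2 + 10)) + N * (1 / (N : ℝ) ^ (k ^ 2 + 10)) := by gcongr
    _ = 2 / (N : ℝ) ^ 9 * (1 / (N : ℝ) ^ k ^ 2) := by rw [h10]; field_simp; ring
    _ < 1 / 2 * (1 / (N : ℝ) ^ k ^ 2) := by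
        refine mul_lt_mul_of_pos_right ?_ (by positivity)
        rw [div_lt_div_iff₀ (by positivity) (by norm_num)]
        linarith
    _ ≤ 1 / 2 * (1 / (Q : ℝ) ^ k.choose 2) := by gcongr
    _ = _ := by rw [one_div_mul_one_div]

open Finset in
theorem Hypergraph.sizeRamsey_tightPath_le_prod {N Q k n h : ℕ} {g : ℕ → ℕ} (hk : 2 ≤ k)
    (hn : 1 ≤ n) (hQ : 0 < Q) (hQN : Q ≤ N) (hh : 16 * k * n ≤ h * Q ^ (k - 1))
    (hN : 8 * h * k * Q ^ (k - 1) + k ≤ N + 1) (hkn : 2 * k * n ≤ N)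
    (hg : ∀ j ∈ Ico 1 k, 8 * N ≤ g j * Q ^ j)
    (hh' : ((k ^ 2 + 3 * k + 10 : ℕ) : ℝ) * Real.log N ≤ h)
    (hg' : ∀ j ∈ Ico 1 k, ((k ^ 2 + 3 * k + 10 : ℕ) : ℝ) * Real.log N ≤ g j) :
    Hypergraph.sizeRamsey k (Hypergraph.tightPath k n) ≤ (N * ∏ j ∈ Ico 1 k, 2 * g j : ℕ) := by
  have : NeZero Q := ⟨hQ.ne'⟩
  have hkN : 2 * k ≤ N := (Nat.le_mul_of_pos_right _ hn).trans hkn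
  have hnN : n ≤ N := (Nat.le_mul_of_pos_left _ (by omega)).trans hkn
  obtain ⟨ω, h1, h2, h3⟩ := exists_zeroCliques (V := Fin N) (Q := Q) (k := k) (n := n) (h := h)
    (g := g) (by omega) hn hh (by simpa using hN) (by simpa using hkn) (by simpa using hg)
    (by
      rw [Fintype.card_fin]
      exact sum_failure_probability_lt hQ hQN (by omega) (by omega) hnN hh' hg')
  refine (Hypergraph.sizeRamsey_tightPath_le (E := zeroCliques ω k) (d := 2 * h) hk hn
    (fun e he => (mem_zeroCliques.1 he).1) ?_ ?_).trans ?_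
  · refine lt_of_le_of_lt ?_ h1
    exact Nat.mul_le_mul_left _ (card_le_card (zeroCliques_shadow ω k))
  · intro B C hB hBn hBc hBd hC
    obtain ⟨β, hβ, hlt⟩ := h2 B C hB hBn hBc hBd hC
    exact ⟨β, hβ, lt_of_le_of_lt (card_le_card
      (inter_subset_inter_right (extensions_zeroCliques_subset ω k β))) hlt⟩
  · have := card_zeroCliques_le_prod h3 (by omega)
    rw [Fintype.card_fin] at this
    exact_mod_cast this

open Finset in
theorem Finset.prod_Ico_one_pow (Q k : ℕ) : ∏ j ∈ Ico 1 k, Q ^ j = Q ^ k.choose 2 := by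
  induction k with
  | zero => simp
  | succ k ih =>
    rcases Nat.eq_zero_or_pos k with rfl | hk
    · simp
    · rw [prod_Ico_succ_top hk, ih, Nat.choose_succ_succ' k 1, Nat.choose_one_right, pow_add,
        mul_comm]

-- Here `h` and `g j` are `16 * k * n / Q ^ (k - 1)` and `8 * N / Q ^ j` rounded up past the
-- quotient. The constant `140` suffices since `8 * k * (16 * k * n + n) + k ≤ 137 * k ^ 2 * n`.
open Finset in
theorem Hypergraph.exists_sizeRamsey_tightPath_le {Q k n : ℕ} (hk : 2 ≤ k) (hn : 1 ≤ n)
    (hQ : 0 < Q) (hQn : Q ^ (k - 1) ≤ n)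
    (hlog : ((k ^ 2 + 3 * k + 10 : ℕ) : ℝ) * Real.log (140 * k ^ 2 * n : ℕ) * (Q : ℝ) ^ (k - 1)
      ≤ (16 * k * n : ℕ)) :
    ∃ m : ℕ, Hypergraph.sizeRamsey k (Hypergraph.tightPath k n) ≤ m ∧
      m * Q ^ k.choose 2 ≤ 18 ^ (k - 1) * (140 * k ^ 2 * n) ^ k := by
  set N := 140 * k ^ 2 * n with hN
  have hkn : n ≤ k ^ 2 * n := Nat.le_mul_of_pos_left _ (by positivity)
  have hkn' : k * n ≤ k ^ 2 * n := Nat.mul_le_mul_right _ (Nat.le_self_pow two_ne_zero k)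
  have hkk : k ≤ k * n := Nat.le_mul_of_pos_right _ hn
  have hNe : N = 140 * (k ^ 2 * n) := by rw [hN]; ring
  have hQ' : 0 < (Q : ℝ) := Nat.cast_pos.2 hQ
  have hpow : ∀ j ∈ Ico 1 k, Q ^ j ≤ Q ^ (k - 1) := fun j hj =>
    Nat.pow_le_pow_right hQ (by rw [mem_Ico] at hj; omega)
  have hQQ : Q ≤ Q ^ (k - 1) := Nat.le_self_pow (by omega) Q
  have hdiv : ∀ a q : ℕ, 0 < q → a ≤ (a / q + 1) * q ∧ (a / q + 1) * q ≤ a + q := by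
    intro a q hq
    have h1 := Nat.div_add_mod a q
    have h2 := Nat.mod_lt a hq
    have h3 : (a / q + 1) * q = q * (a / q) + q := by ring
    omega
  obtain ⟨hh1, hh2⟩ := hdiv (16 * k * n) (Q ^ (k - 1)) (by positivity)
  set h := 16 * k * n / Q ^ (k - 1) + 1 with hh
  let g : ℕ → ℕ := fun j => 8 * N / Q ^ j + 1
  have hg : ∀ j, 8 * N ≤ g j * Q ^ j ∧ g j * Q ^ j ≤ 8 * N + Q ^ j := fun j =>
    hdiv (8 * N) (Q ^ j) (by positivity)
  have e1 : 16 * k * n = 16 * (k * n) := by ring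
  refine ⟨N * ∏ j ∈ Ico 1 k, 2 * g j, Hypergraph.sizeRamsey_tightPath_le_prod (h := h) (Q := Q) hk
    hn hQ (by omega) hh1 ?_ ?_ (fun j _ => (hg j).1) ?_ ?_, ?_⟩
  · calc 8 * h * k * Q ^ (k - 1) + k = 8 * k * (h * Q ^ (k - 1)) + k := by ring
      _ ≤ 8 * k * (16 * k * n + n) + k := by gcongr; omega
      _ = 128 * (k ^ 2 * n) + 8 * (k * n) + k := by ring
      _ ≤ N + 1 := by omega
  · have e2 : 2 * k * n = 2 * (k * n) := by ring
    omega
  · refine le_of_mul_le_mul_right (hlog.trans ?_) (pow_pos hQ' (k - 1))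
    exact_mod_cast hh1
  · intro j hj
    refine le_of_mul_le_mul_right (hlog.trans ?_) (pow_pos hQ' (k - 1))
    have : 16 * k * n ≤ g j * Q ^ (k - 1) := by
      calc 16 * k * n ≤ 8 * N := by omega
        _ ≤ g j * Q ^ j := (hg j).1
        _ ≤ g j * Q ^ (k - 1) := Nat.mul_le_mul_left _ (hpow j hj)
    exact_mod_cast this
  · calc N * (∏ j ∈ Ico 1 k, 2 * g j) * Q ^ k.choose 2
        = N * ∏ j ∈ Ico 1 k, 2 * g j * Q ^ j := by
          rw [← prod_Ico_one_pow, mul_assoc, ← prod_mul_distrib]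
      -- `2 * g j * Q ^ j ≤ 2 * (8 * N + Q ^ j) ≤ 18 * N`, as `Q ^ j ≤ n ≤ N`.
      _ ≤ N * ∏ j ∈ Ico 1 k, 18 * N := by
          refine Nat.mul_le_mul_left _ (prod_le_prod' fun j hj => ?_)
          have h1 := (hg j).2
          have h2 := hpow j hj
          rw [mul_assoc]
          omega
      _ = 18 ^ (k - 1) * N ^ k := by
          rw [prod_const, Nat.card_Ico, mul_pow]
          conv_rhs => rw [← Nat.sub_add_cancel (show 1 ≤ k by omega), pow_succ]
          simp only [Nat.add_sub_cancel]
          ring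

open Finset in
theorem Nat.le_choose_two_add_one (m : ℕ) : m ≤ m.choose 2 + 1 := by
  induction m with
  | zero => simp
  | succ m ih =>
    rw [Nat.choose_succ_succ' m 1, Nat.choose_one_right]
    rcases Nat.eq_zero_or_pos (m.choose 2) with h | h
    · rw [Nat.choose_eq_zero_iff] at h
      omega
    · omega

theorem Hypergraph.exists_forall_sizeRamsey_tightPath_le (k : ℕ) (hk : 3 ≤ k) (α : ℝ)
    (hα : α = ((k : ℝ) - 2) / (((k - 1).choose 2 : ℝ) + 1)) :
    ∃ C : ℝ, ∀ᶠ n : ℕ in atTop, ∃ m : ℕ,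
      Hypergraph.sizeRamsey k (Hypergraph.tightPath k n) ≤ m ∧
      (m : ℝ) ≤ C * ((n : ℝ) ^ ((k : ℝ) - 1 - α) * (Real.log (n : ℝ)) ^ (1 + α)) := by
  set K : ℝ := ((k ^ 2 + 3 * k + 10 : ℕ) : ℝ) with hK
  have hK1 : (1 : ℝ) ≤ K := by
    rw [hK]; exact_mod_cast (show 1 ≤ k ^ 2 + 3 * k + 10 by omega)
  have hK0 : 0 < K := by linarith
  set D : ℕ := (k - 1).choose 2 + 1 with hD
  have hD0 : (D : ℝ) ≠ 0 := by positivity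
  have hDk : k - 1 ≤ D := Nat.le_choose_two_add_one _
  -- Pascal's rule gives `k.choose 2 = (k - 2) + D`.
  have hαD : 1 + α = (k.choose 2 : ℝ) / D := by
    have h1 : k.choose 2 = (k - 1) + (k - 1).choose 2 := by
      conv_lhs => rw [← Nat.sub_add_cancel (show 1 ≤ k by omega)]
      rw [Nat.choose_succ_succ' (k - 1) 1, Nat.choose_one_right]
    have h2 : (k.choose 2 : ℝ) = (k : ℝ) - 1 + ((k - 1).choose 2 : ℝ) := by
      rw [h1]; push_cast [Nat.cast_sub (show 1 ≤ k by omega)]; ring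
    have h3 : (D : ℝ) = ((k - 1).choose 2 : ℝ) + 1 := by rw [hD]; push_cast; ring
    rw [hα, h2, ← h3, eq_div_iff hD0, add_mul, div_mul_cancel₀ _ hD0, h3]
    ring
  have hlittle : ∀ᶠ n : ℕ in atTop, K * Real.log n ≤ n := by
    have h1 := (Real.isLittleO_log_id_atTop.comp_tendsto
      (tendsto_natCast_atTop_atTop (R := ℝ))).bound (inv_pos.2 hK0)
    filter_upwards [h1] with n hn
    simp only [Function.comp_apply, id, Real.norm_eq_abs, Nat.abs_cast] at hn
    rw [inv_mul_eq_div, le_div_iff₀ hK0] at hn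
    calc K * Real.log n ≤ K * |Real.log n| := by gcongr; exact le_abs_self _
      _ ≤ n := by linarith
  refine ⟨18 ^ (k - 1) * (140 * k ^ 2) ^ k * 2 ^ k.choose 2 * K ^ (1 + α), ?_⟩
  filter_upwards [hlittle, eventually_ge_atTop (140 * k ^ 2), eventually_ge_atTop 3]
    with n hn1 hn2 hn3
  have hn0 : (0 : ℝ) < n := by exact_mod_cast (show 0 < n by omega)
  have hlogn : 1 ≤ Real.log n := by
    rw [Real.le_log_iff_exp_le hn0]
    have h3 : (3 : ℝ) ≤ n := by exact_mod_cast hn3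
    linarith [Real.exp_one_lt_d9]
  set x : ℝ := n / (K * Real.log n) with hx
  have hKl : 0 < K * Real.log n := by positivity
  have hx1 : 1 ≤ x := by rwa [hx, le_div_iff₀ hKl, one_mul]
  have hx0 : 0 ≤ x := by linarith
  have hxn : x ≤ n := div_le_self hn0.le (by nlinarith)
  -- With `Q = ⌊y⌋₊`, the power `Q ^ k.choose 2` is `x ^ (1 + α)` up to the factor `2 ^ k.choose 2`.
  -- The construction only asks for `Q ^ (k - 1) ≤ x`, which follows from `k - 1 ≤ D`.
  set y : ℝ := x ^ ((D : ℝ)⁻¹) with hy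
  have hy1 : 1 ≤ y := Real.one_le_rpow hx1 (by positivity)
  have hyD : y ^ D = x := Real.rpow_inv_natCast_pow hx0 (by omega)
  set Q : ℕ := ⌊y⌋₊ with hQ
  have hQ1 : 1 ≤ Q := (Nat.one_le_floor_iff y).2 hy1
  have hQ1' : (1 : ℝ) ≤ Q := by exact_mod_cast hQ1
  have hQy : (Q : ℝ) ≤ y := Nat.floor_le (by linarith)
  have hyQ : y ≤ 2 * Q := by
    have := Nat.lt_floor_add_one y
    linarith
  have hQx : (Q : ℝ) ^ (k - 1) ≤ x := by
    calc (Q : ℝ) ^ (k - 1) ≤ (Q : ℝ) ^ D := pow_le_pow_right₀ hQ1' hDk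
      _ ≤ y ^ D := by gcongr
      _ = x := hyD
  have hlogN : Real.log (140 * k ^ 2 * n : ℕ) ≤ 2 * Real.log n := by
    have h1 : 140 * k ^ 2 * n ≤ n ^ 2 := by rw [sq n]; exact Nat.mul_le_mul_right n hn2
    calc Real.log (140 * k ^ 2 * n : ℕ) ≤ Real.log ((n ^ 2 : ℕ) : ℝ) := by
          gcongr
      _ = 2 * Real.log n := by push_cast; rw [Real.log_pow]; norm_num
  obtain ⟨m, hm, hmQ⟩ := Hypergraph.exists_sizeRamsey_tightPath_le (Q := Q) (k := k) (n := n)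
    (by omega) (by omega) hQ1 (by exact_mod_cast hQx.trans hxn) (by
      calc K * Real.log (140 * k ^ 2 * n : ℕ) * (Q : ℝ) ^ (k - 1)
          ≤ K * (2 * Real.log n) * x := by gcongr
        _ = 2 * n := by rw [hx]; field_simp
        _ ≤ (16 * k * n : ℕ) := by
          exact_mod_cast Nat.mul_le_mul_right n (show 2 ≤ 16 * k by omega))
  refine ⟨m, hm, ?_⟩
  have hyα : y ^ k.choose 2 = x ^ (1 + α) := by
    rw [hy, ← Real.rpow_natCast, ← Real.rpow_mul hx0, hαD]
    congr 1
    field_simp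
  have hmR : (m : ℝ) * (Q : ℝ) ^ k.choose 2 ≤ 18 ^ (k - 1) * (140 * k ^ 2 * n) ^ k := by
    exact_mod_cast hmQ
  have hmx : (m : ℝ) * x ^ (1 + α)
      ≤ 2 ^ k.choose 2 * (18 ^ (k - 1) * (140 * k ^ 2 * n) ^ k) := by
    calc (m : ℝ) * x ^ (1 + α) ≤ m * (2 * Q) ^ k.choose 2 := by rw [← hyα]; gcongr
      _ = 2 ^ k.choose 2 * (m * (Q : ℝ) ^ k.choose 2) := by rw [mul_pow]; ring
      _ ≤ _ := by gcongr
  have hxα : x ^ (1 + α) = (n : ℝ) ^ (1 + α) / (K ^ (1 + α) * Real.log n ^ (1 + α)) := by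
    rw [hx, Real.div_rpow hn0.le hKl.le, Real.mul_rpow hK0.le (by linarith)]
  have hnk : (n : ℝ) ^ k = (n : ℝ) ^ ((k : ℝ) - 1 - α) * (n : ℝ) ^ (1 + α) := by
    rw [← Real.rpow_add hn0, ← Real.rpow_natCast]
    congr 1
    ring
  have hxpos : 0 < x ^ (1 + α) := Real.rpow_pos_of_pos (by linarith) _
  refine le_of_mul_le_mul_right (hmx.trans (le_of_eq ?_)) hxpos
  rw [hxα, mul_pow, hnk]
  have h1 : 0 < K ^ (1 + α) := Real.rpow_pos_of_pos hK0 _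
  have h2 : 0 < Real.log n ^ (1 + α) := Real.rpow_pos_of_pos (by linarith) _
  field_simp

theorem theorem4 (k : ℕ) (hk : 3 ≤ k) (α : ℝ)
    (hα : α = ((k : ℝ) - 2) / (((k - 1).choose 2 : ℝ) + 1)) :
    (∀ n : ℕ, Hypergraph.sizeRamsey k (Hypergraph.tightPath k n) ≠ ⊤) ∧
    (fun n : ℕ => ((Hypergraph.sizeRamsey k (Hypergraph.tightPath k n)).toNat : ℝ)) =O[atTop]
      (fun n : ℕ => (n : ℝ) ^ ((k : ℝ) - 1 - α) * (Real.log (n : ℝ)) ^ (1 + α)) := by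
  obtain ⟨C, hC⟩ := Hypergraph.exists_forall_sizeRamsey_tightPath_le k hk α hα
  constructor
  · intro n
    obtain ⟨m, ⟨M, hM, -⟩, hnm⟩ := (hC.and (eventually_ge_atTop n)).exists
    exact ne_top_of_le_ne_top (ENat.natCast_ne_top M)
      ((Hypergraph.sizeRamsey_tightPath_mono hnm).trans hM)
  · refine IsBigO.of_bound C ?_
    filter_upwards [hC] with n hn
    obtain ⟨m, hm, hmC⟩ := hn
    have h1 : (Hypergraph.sizeRamsey k (Hypergraph.tightPath k n)).toNat ≤ m :=
      ENat.toNat_le_of_le_natCast hm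
    have h2 : 0 ≤ (n : ℝ) ^ ((k : ℝ) - 1 - α) * (Real.log (n : ℝ)) ^ (1 + α) :=
      mul_nonneg (Real.rpow_nonneg (Nat.cast_nonneg n) _)
        (Real.rpow_nonneg (Real.log_natCast_nonneg n) _)
    rw [Real.norm_of_nonneg (Nat.cast_nonneg _), Real.norm_of_nonneg h2]
    exact (Nat.cast_le.2 h1).trans hmC
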